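/- Let $R$ be a Prüfer domain with quotient field $K$, i.e. an integral domain in which every nonzero finitely generated ideal is invertible. Suppose that $R$ is either (a) semilocal, i.e. it has only finitely many maximal ideals; or (b) locally finite and of finite Krull dimension, where $R$ is called locally finite if every nonzero $x\in R$ is a nonunit in only finitely many of the localizations $R_M$, $M\in\operatorname{Max}(R)$. A fractional ideal of $R$ is an $R$-submodule $I$ of $K$ such that $dI\subseteq R$ for some nonzero $d\in R$. A star operation on $R$ is a map $I\mapsto I^\star$ from the set of fractional ideals of $R$ to itself such that, for all fractional ideals $I,J$ and all $x\in K$: $I\subseteq I^\star$; $(I^\star)^\star=I^\star$; $I\subseteq J$ implies $I^\star\subseteq J^\star$; $R^\star=R$; and $(xI)^\star=xI^\star$. The $v$-operation on $R$ is the star operation $I\mapsto I^v=(R:(R:I))$ for $I\neq(0)$ (with $(0)^v=(0)$), where $(R:I)=\{x\in K\mid xI\subseteq R\}$. A star operation $\star$ distributes over finite intersections if $(I\cap J)^\star=I^\star\cap J^\star$ for all fractional ideals $I,J$; it distributes over arbitrary intersections if $\left(\bigcap_{\alpha\in A}I_\alpha\right)^\star=\bigcap_{\alpha\in A}I_\alpha^\star$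 for every nonempty family $\{I_\alpha\}_{\alpha\in A}$ of fractional ideals with nonzero intersection. The domain $R$ is $h$-local if it is locally finite and every nonzero prime ideal of $R$ is contained in only one maximal ideal. Then the following are equivalent: (i) $R$ is $h$-local; (ii) every star operation on $R$ distributes over arbitrary intersections; (iii) every star operation on $R$ distributes over finite intersections; (iv) the $v$-operation on $R$ distributes over arbitrary intersections; (v) the $v$-operation on $R$ distributes over finite intersections; (vi) for every fractional ideal $I$ of $R$, $I^v=\bigcap\{(IR_M)^{v_{R_M}}\mid M\in\operatorname{Max}(R)\}$, where $v_{R_M}$ denotes the $v$-operation on the domain $R_M$ and $IR_M$ is the fractional ideal of $R_M$ generated by $I$. -/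

import Mathlib

open scoped nonZeroDivisors

/-- A Prüfer domain: every nonzero finitely generated ideal is invertible
(in the monoid of fractional ideals). -/
def IsPruferDomain (R : Type*) [CommRing R] [IsDomain R] : Prop :=
  ∀ I : Ideal R, I ≠ ⊥ → I.FG → IsUnit (I : FractionalIdeal R⁰ (FractionRing R))

/-- A semilocal ring: only finitely many maximal ideals. -/
def IsSemilocalRing (R : Type*) [CommRing R] : Prop :=
  Finite (MaximalSpectrum R)

/-- A locally finite domain (domain of finite character): every nonzero element of `R` is a nonunit
in only finitely many of the localizations of `R` at maximal ideals. -/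
def IsLocallyFiniteDomain (R : Type*) [CommRing R] : Prop :=
  ∀ x : R, x ≠ 0 → {M : MaximalSpectrum R |
    ¬ IsUnit (algebraMap R (Localization.AtPrime M.asIdeal) x)}.Finite

/-- An `h`-local domain: it is locally finite and every nonzero prime ideal is contained in only
one maximal ideal. -/
def IsHLocal (R : Type*) [CommRing R] : Prop :=
  IsLocallyFiniteDomain R ∧
    ∀ P : Ideal R, P.IsPrime → P ≠ ⊥ → ∃! M : Ideal R, M.IsMaximal ∧ P ≤ M

/-- A star operation on the domain `R` with quotient field `K`. -/
structure StarOperation (R K : Type*) [CommRing R] [IsDomain R] [Field K] [Algebra R K]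
    [IsFractionRing R K] where
  /-- The underlying map on fractional ideals. -/
  toFun : FractionalIdeal R⁰ K → FractionalIdeal R⁰ K
  le_apply : ∀ I, I ≤ toFun I
  idem : ∀ I, toFun (toFun I) = toFun I
  mono : ∀ I J, I ≤ J → toFun I ≤ toFun J
  map_one : toFun 1 = 1
  map_smul : ∀ (x : K) (I), toFun (FractionalIdeal.spanSingleton R⁰ x * I) =
    FractionalIdeal.spanSingleton R⁰ x * toFun I

namespace StarOperation

variable {R K : Type*} [CommRing R] [IsDomain R] [Field K] [Algebra R K] [IsFractionRing R K]

/-- `⋆` distributes over arbitrary intersections: if `S` is a nonempty family of fractional ideals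
whose intersection `J` is nonzero, then `J^⋆` is the intersection of the `I^⋆` for `I ∈ S`. -/
def DistributesOverIntersections (star : StarOperation R K) : Prop :=
  ∀ (S : Set (FractionalIdeal R⁰ K)) (J : FractionalIdeal R⁰ K), S.Nonempty → J ≠ 0 →
    (J : Submodule R K) = ⨅ I ∈ S, (I : Submodule R K) →
    (star.toFun J : Submodule R K) = ⨅ I ∈ S, (star.toFun I : Submodule R K)

/-- `⋆` distributes over finite intersections (`⋆` is stable). -/
def DistributesOverFiniteIntersections (star : StarOperation R K) : Prop :=
  ∀ I J : FractionalIdeal R⁰ K, star.toFun (I ⊓ J) = star.toFun I ⊓ star.toFun J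

end StarOperation

section

variable (R K : Type*) [CommRing R] [IsDomain R] [Field K] [Algebra R K] [IsFractionRing R K]

theorem FractionalIdeal.one_div_ne_zero_of_ne_zero {I : FractionalIdeal R⁰ K} (hI : I ≠ 0) :
    1 / I ≠ 0 := by
  obtain ⟨a, ha, h⟩ := I.isFractional
  have hmem : algebraMap R K a ∈ 1 / I := by
    rw [FractionalIdeal.mem_div_iff_of_ne_zero hI]
    intro y hy
    obtain ⟨r, hr⟩ := h y hy
    rw [FractionalIdeal.mem_one_iff]
    exact ⟨r, by rw [hr, Algebra.smul_def]⟩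
  intro h0
  rw [h0, FractionalIdeal.mem_zero_iff] at hmem
  exact nonZeroDivisors.ne_zero ha ((IsFractionRing.injective R K) (by simpa using hmem))

theorem FractionalIdeal.le_one_div_one_div (I : FractionalIdeal R⁰ K) : I ≤ 1 / (1 / I) := by
  by_cases hI : I = 0
  · subst hI; simp
  · rw [FractionalIdeal.le_div_iff_mul_le
      (FractionalIdeal.one_div_ne_zero_of_ne_zero R K hI)]
    exact FractionalIdeal.mul_one_div_le_one

theorem FractionalIdeal.one_div_anti {I J : FractionalIdeal R⁰ K} (hI : I ≠ 0) (h : I ≤ J) :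
    1 / J ≤ 1 / I := by
  rw [FractionalIdeal.le_div_iff_mul_le hI]
  calc 1 / J * I ≤ 1 / J * J := by gcongr
    _ = J * (1 / J) := mul_comm _ _
    _ ≤ 1 := FractionalIdeal.mul_one_div_le_one

theorem FractionalIdeal.one_div_spanSingleton_mul (x : K) (hx : x ≠ 0)
    (I : FractionalIdeal R⁰ K) :
    1 / (FractionalIdeal.spanSingleton R⁰ x * I) =
      FractionalIdeal.spanSingleton R⁰ x⁻¹ * (1 / I) := by
  have hinv : FractionalIdeal.spanSingleton R⁰ x⁻¹ * FractionalIdeal.spanSingleton R⁰ x = 1 := by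
    rw [FractionalIdeal.spanSingleton_mul_spanSingleton, inv_mul_cancel₀ hx,
      FractionalIdeal.spanSingleton_one]
  by_cases hI : I = 0
  · subst hI; simp
  have hxI : FractionalIdeal.spanSingleton R⁰ x * I ≠ 0 := by
    intro h
    apply hI
    rw [← one_mul I, ← hinv, mul_assoc, h, mul_zero]
  apply le_antisymm
  · have h1 : FractionalIdeal.spanSingleton R⁰ x *
        (1 / (FractionalIdeal.spanSingleton R⁰ x * I)) ≤ 1 / I := by
      rw [FractionalIdeal.le_div_iff_mul_le hI]
      calc _ = (FractionalIdeal.spanSingleton R⁰ x * I) *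
            (1 / (FractionalIdeal.spanSingleton R⁰ x * I)) := by ring
        _ ≤ 1 := FractionalIdeal.mul_one_div_le_one
    calc _ = FractionalIdeal.spanSingleton R⁰ x⁻¹ * (FractionalIdeal.spanSingleton R⁰ x *
            (1 / (FractionalIdeal.spanSingleton R⁰ x * I))) := by
          rw [← mul_assoc, hinv, one_mul]
      _ ≤ _ := by gcongr
  · rw [FractionalIdeal.le_div_iff_mul_le hxI]
    calc _ = (FractionalIdeal.spanSingleton R⁰ x⁻¹ * FractionalIdeal.spanSingleton R⁰ x) *
          (I * (1 / I)) := by ring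
      _ = I * (1 / I) := by rw [hinv, one_mul]
      _ ≤ 1 := FractionalIdeal.mul_one_div_le_one

/-- The `v`-operation (divisorial closure) `I ↦ (R : (R : I))`. Since `J / 0 = 0` for fractional
ideals, the zero ideal is sent to itself, as for every star operation. -/
noncomputable def vOperation : StarOperation R K where
  toFun I := 1 / (1 / I)
  le_apply I := FractionalIdeal.le_one_div_one_div R K I
  idem I := by
    by_cases hI : I = 0
    · subst hI; simp
    have h1 := FractionalIdeal.one_div_ne_zero_of_ne_zero R K hI
    congr 1
    exact le_antisymm (FractionalIdeal.one_div_anti R K hI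
      (FractionalIdeal.le_one_div_one_div R K I)) (FractionalIdeal.le_one_div_one_div R K (1 / I))
  mono I J h := by
    by_cases hI : I = 0
    · subst hI; simp
    have hJ : J ≠ 0 := fun h0 => hI (le_antisymm (h0 ▸ h) (FractionalIdeal.zero_le I))
    exact FractionalIdeal.one_div_anti R K (FractionalIdeal.one_div_ne_zero_of_ne_zero R K hJ)
      (FractionalIdeal.one_div_anti R K hI h)
  map_one := by simp
  map_smul x I := by
    by_cases hx : x = 0
    · subst hx; simp
    rw [FractionalIdeal.one_div_spanSingleton_mul R K x hx,
      FractionalIdeal.one_div_spanSingleton_mul R K x⁻¹ (inv_ne_zero hx), inv_inv]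

/-- The localization `R_M` of `R` at a maximal ideal `M`, as an overring of `R` inside `K`. -/
noncomputable abbrev localizationIn (M : MaximalSpectrum R) : Subalgebra R K :=
  Localization.subalgebra.ofField K M.asIdeal.primeCompl M.asIdeal.primeCompl_le_nonZeroDivisors

variable {R K}

/-- The extension `IT` of a fractional ideal `I` of `R` to an overring `T` of `R`:
the `T`-submodule of `K` generated by `I`. -/
noncomputable def extendToOverring (T : Subalgebra R K) (I : FractionalIdeal R⁰ K) :
    FractionalIdeal T⁰ K :=
  ⟨Submodule.span T (I : Set K), by
    obtain ⟨a, ha, h⟩ := I.isFractional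
    refine ⟨algebraMap R T a, ?_, ?_⟩
    · rw [mem_nonZeroDivisors_iff_ne_zero]
      intro h0
      apply nonZeroDivisors.ne_zero ha
      apply IsFractionRing.injective R K
      rw [map_zero, IsScalarTower.algebraMap_apply R T K, h0, map_zero]
    · intro y hy
      induction hy using Submodule.span_induction with
      | mem y hy =>
        obtain ⟨r, hr⟩ := h y hy
        exact ⟨algebraMap R T r, by
          rw [← IsScalarTower.algebraMap_apply R T K, hr, algebraMap_smul]⟩
      | zero => rw [smul_zero]; exact ⟨0, map_zero _⟩
      | add y z _ _ hy hz => rw [smul_add]; exact IsLocalization.isInteger_add hy hz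
      | smul t y _ hy => rw [smul_comm]; exact IsLocalization.isInteger_smul hy⟩

end

/-! ### Local finiteness, local-global membership, common primes of two ideals. -/

section Ring

variable {R : Type*} [CommRing R]

/-! Both alternatives (a) and (b) make R locally finite, and every R_M is a valuation domain because
R is Prüfer.

Let R be h-local. For M ≠ N the compositum of R_M and R_N is K, so by local finiteness the
containment I R_M ⊆ y R_M is achieved by a single denominator outside M
(`IsHLocal.exists_forall_smul_mem_span`). Hence if y ∈ I^⋆ is not in I R_M, then M^⋆ = R, and in any
case yM ⊆ I R_M. For y in every I^⋆ only finitely many such M matter; their product A satisfies A^⋆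
= R and yA ⊆ ⋂ I, so y ∈ (⋂ I)^⋆. The same denominators make (R : I), hence v, localize, which is
(vi). Fractional ideals of a valuation domain are comparable, so (vi) gives (v).

Conversely, let v be stable and P ≠ 0 a largest prime inside two distinct maximal ideals M and N.
Intersecting the localizations off the branch of M, resp. of N, above P yields overrings I, J with I
∩ J = R and (R : I) = (R : J) = P. Then R = I^v ∩ J^v contains J, so 1 ∈ (R : J) = P, which is
absurd (`IsLargestCommonPrime.eq_bot`). -/

theorem isLocallyFiniteDomain_iff :
    IsLocallyFiniteDomain R ↔
      ∀ x : R, x ≠ 0 → {M : MaximalSpectrum R | x ∈ M.asIdeal}.Finite := by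
  refine forall₂_congr fun x _ => ?_
  have : {M : MaximalSpectrum R | ¬ IsUnit (algebraMap R (Localization.AtPrime M.asIdeal) x)} =
      {M : MaximalSpectrum R | x ∈ M.asIdeal} := by
    ext M
    simp only [Set.mem_ofPred_eq,
      IsLocalization.AtPrime.isUnit_to_map_iff (Localization.AtPrime M.asIdeal) M.asIdeal x,
      Ideal.mem_primeCompl_iff, not_not]
  rw [this]

theorem IsSemilocalRing.isLocallyFiniteDomain (h : IsSemilocalRing R) :
    IsLocallyFiniteDomain R := by
  have : Finite (MaximalSpectrum R) := h
  exact fun x _ => Set.toFinite _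

/-- If no prime ideal inside `M ⊓ N` contains `z`, then `1 / z` lies in the compositum of the
localizations at `M` and `N`. -/
theorem Ideal.exists_dvd_mul_of_forall_prime_notMem {M N : Ideal R} [M.IsPrime] [N.IsPrime] {z : R}
    (h : ∀ Q : Ideal R, Q.IsPrime → Q ≤ M → Q ≤ N → z ∉ Q) :
    ∃ s ∉ M, ∃ u ∉ N, z ∣ u * s := by
  by_contra! hc
  -- A prime avoiding the monoid generated by both complements lies in M and in N.
  obtain ⟨Q, hQ, hzQ, hd⟩ := Ideal.exists_le_prime_disjoint (Ideal.span {z})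
    (M.primeCompl ⊔ N.primeCompl) (by
      rw [Set.disjoint_left]
      intro x hx hxS
      obtain ⟨s, hs, u, hu, rfl⟩ := Submonoid.mem_sup.1 hxS
      exact hc s hs u hu (by rw [mul_comm]; exact Ideal.mem_span_singleton.1 hx))
  rw [Set.disjoint_left] at hd
  refine h Q hQ (fun x hx => ?_) (fun x hx => ?_) (hzQ (Ideal.mem_span_singleton_self z))
  · by_contra hxM
    exact hd hx (Submonoid.mem_sup_left (show x ∈ M.primeCompl from hxM))
  · by_contra hxN
    exact hd hx (Submonoid.mem_sup_right (show x ∈ N.primeCompl from hxN))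

/-- A uniform version of `Ideal.exists_dvd_mul_of_forall_prime_notMem` for a family `S` of maximal
ideals of a locally finite domain. -/
theorem IsLocallyFiniteDomain.exists_forall_dvd_mul (hR : IsLocallyFiniteDomain R) {z : R}
    (hz : z ≠ 0) (M : MaximalSpectrum R) (S : Set (MaximalSpectrum R))
    (h : ∀ N ∈ S, ∀ Q : Ideal R, Q.IsPrime → Q ≤ M.asIdeal → Q ≤ N.asIdeal → z ∉ Q) :
    ∃ s ∉ M.asIdeal, ∀ N ∈ S, ∃ u ∉ N.asIdeal, z ∣ u * s := by
  classical
  have hfin := (isLocallyFiniteDomain_iff.1 hR z hz).inter_of_left S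
  choose! s hs hsN using fun N hN => Ideal.exists_dvd_mul_of_forall_prime_notMem (h N hN)
  -- Only the finitely many N containing z need a factor; elsewhere u = z works.
  refine ⟨∏ N ∈ hfin.toFinset, s N, ?_, fun N hN => ?_⟩
  · refine prod_mem (S := M.asIdeal.primeCompl) fun N hN => hs N ?_
    simpa using (hfin.mem_toFinset.1 hN).2
  · by_cases hzN : z ∈ N.asIdeal
    · obtain ⟨u, hu, hd⟩ := hsN N hN
      exact ⟨u, hu, hd.trans (mul_dvd_mul_left u
        (Finset.dvd_prod_of_mem s (hfin.mem_toFinset.2 ⟨hzN, hN⟩)))⟩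
    · exact ⟨z, hzN, dvd_mul_right _ _⟩

theorem Ideal.eq_top_of_forall_maximalSpectrum {I : Ideal R}
    (h : ∀ M : MaximalSpectrum R, ∃ u ∉ M.asIdeal, u ∈ I) : I = ⊤ := by
  by_contra hI
  obtain ⟨M, hM, hIM⟩ := Ideal.exists_le_maximal I hI
  obtain ⟨u, hu, huI⟩ := h ⟨M, hM⟩
  exact hu (hIM huI)

theorem Submodule.mem_of_forall_maximalSpectrum {V : Type*} [AddCommGroup V] [Module R V]
    {I : Submodule R V} {x : V} (h : ∀ M : MaximalSpectrum R, ∃ u ∉ M.asIdeal, u • x ∈ I) :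
    x ∈ I := by
  have : (I.comap (LinearMap.toSpanSingleton R V x)) = ⊤ :=
    Ideal.eq_top_of_forall_maximalSpectrum h
  have h1 : (1 : R) ∈ I.comap (LinearMap.toSpanSingleton R V x) := this ▸ Submodule.mem_top
  simpa using h1

/-- A prime ideal inside an ideal `J` is contained in a maximal such prime. -/
theorem Ideal.exists_le_maximal_isPrime_le {P J : Ideal R} [hP : P.IsPrime] (hPJ : P ≤ J) :
    ∃ Q, P ≤ Q ∧ Maximal (fun Q : Ideal R => Q.IsPrime ∧ Q ≤ J) Q := by
  refine zorn_le_nonempty₀ {Q : Ideal R | Q.IsPrime ∧ Q ≤ J} ?_ P ⟨hP, hPJ⟩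
  intro c hc hchain y hy
  have hmem : ∀ {x : R}, x ∈ sSup c ↔ ∃ Q ∈ c, x ∈ Q := fun {x} =>
    Submodule.mem_sSup_of_directed ⟨y, hy⟩ hchain.directedOn
  refine ⟨sSup c, ⟨⟨?_, ?_⟩, sSup_le fun Q hQ => (hc hQ).2⟩, fun Q hQ => le_sSup hQ⟩
  · rw [Ne, Ideal.eq_top_iff_one, hmem]
    rintro ⟨Q, hQ, h1⟩
    exact (hc hQ).1.ne_top (Ideal.eq_top_iff_one Q |>.2 h1)
  · intro a b hab
    obtain ⟨Q, hQ, h⟩ := hmem.1 hab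
    exact ((hc hQ).1.mem_or_mem h).imp (fun h => hmem.2 ⟨Q, hQ, h⟩) fun h => hmem.2 ⟨Q, hQ, h⟩

end Ring

/-! ### Localizations of a Prüfer domain are valuation domains. -/

section Prufer

variable {R : Type*} [CommRing R] [IsDomain R]

/-- If neither divisibility held in R_M, then aq and bq would lie in M for every q in the inverse of
(a, b), by a(bq) = (aq)b; so (a, b)(a, b)⁻¹ = R would lie in M. -/
theorem IsPruferDomain.exists_dvd_mul_or_dvd_mul (hR : IsPruferDomain R) (M : Ideal R)
    [hM : M.IsPrime] (a b : R) : ∃ s ∉ M, b ∣ s * a ∨ a ∣ s * b := by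
  have h1M : (1 : R) ∉ M := fun h => hM.ne_top (M.eq_top_iff_one.2 h)
  by_cases ha : a = 0
  · exact ⟨1, h1M, Or.inl (by simp [ha])⟩
  let I : Ideal R := Ideal.span {a, b}
  have hI0 : I ≠ ⊥ := fun h => ha (by
    have : a ∈ I := Ideal.subset_span (by simp)
    rwa [h] at this)
  have hI := (FractionalIdeal.mul_inv_cancel_iff_isUnit (FractionRing R)).2
    (hR I hI0 (Submodule.fg_span (Set.toFinite _)))
  have hI0' : (I : FractionalIdeal R⁰ (FractionRing R)) ≠ 0 := by simpa using hI0
  have hmem : ∀ q ∈ (I : FractionalIdeal R⁰ (FractionRing R))⁻¹,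
      ∃ a' b' : R, algebraMap R (FractionRing R) a' = algebraMap R _ a * q ∧
        algebraMap R (FractionRing R) b' = algebraMap R _ b * q := by
    intro q hq
    rw [FractionalIdeal.mem_inv_iff hI0'] at hq
    obtain ⟨a', ha'⟩ := (FractionalIdeal.mem_one_iff _).1 (hq _
      (FractionalIdeal.mem_coeIdeal_of_mem _ (Ideal.subset_span (by simp : a ∈ ({a, b} : Set R)))))
    obtain ⟨b', hb'⟩ := (FractionalIdeal.mem_one_iff _).1 (hq _
      (FractionalIdeal.mem_coeIdeal_of_mem _ (Ideal.subset_span (by simp : b ∈ ({a, b} : Set R)))))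
    exact ⟨a', b', by rw [ha', mul_comm], by rw [hb', mul_comm]⟩
  by_contra! hc
  have key : (I : FractionalIdeal R⁰ (FractionRing R)) * (I : FractionalIdeal R⁰ _)⁻¹ ≤
      (M : FractionalIdeal R⁰ (FractionRing R)) := by
    rw [FractionalIdeal.mul_le]
    intro p hp q hq
    obtain ⟨a', b', ha', hb'⟩ := hmem q hq
    have hab : b * a' = a' * b ∧ a * b' = a' * b := by
      constructor
      · ring
      · apply IsFractionRing.injective R (FractionRing R)
        rw [map_mul, map_mul, ha', hb']
        ring
    have ha'M : a' ∈ M := by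
      by_contra h
      exact (hc a' h).2 ⟨b', hab.2.symm⟩
    have hb'M : b' ∈ M := by
      by_contra h
      exact (hc b' h).1 ⟨a', by rw [hab.1, ← hab.2, mul_comm]⟩
    obtain ⟨p', hp', rfl⟩ := (FractionalIdeal.mem_coeIdeal _).1 hp
    obtain ⟨c, d, rfl⟩ := Ideal.mem_span_pair.1 hp'
    refine (FractionalIdeal.mem_coeIdeal _).2
      ⟨c * a' + d * b', M.add_mem (M.mul_mem_left _ ha'M) (M.mul_mem_left _ hb'M), ?_⟩
    simp only [map_add, map_mul, ha', hb']
    ring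
  rw [hI] at key
  obtain ⟨x, hx, hx1⟩ := (FractionalIdeal.mem_coeIdeal _).1 (key (FractionalIdeal.one_mem_one _))
  rw [← map_one (algebraMap R (FractionRing R))] at hx1
  exact h1M (IsFractionRing.injective R (FractionRing R) hx1 ▸ hx)

theorem IsPruferDomain.exists_smul_eq_smul_or (hR : IsPruferDomain R) {K : Type*} [Field K]
    [Algebra R K] [IsFractionRing R K] (M : Ideal R) [M.IsPrime] (x y : K) :
    ∃ s ∉ M, (∃ r : R, s • x = r • y) ∨ ∃ r : R, s • y = r • x := by
  obtain ⟨a, c, hc, rfl⟩ := IsFractionRing.div_surjective R x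
  obtain ⟨b, d, hd, rfl⟩ := IsFractionRing.div_surjective R y
  have hc' : algebraMap R K c ≠ 0 := IsFractionRing.to_map_ne_zero_of_mem_nonZeroDivisors hc
  have hd' : algebraMap R K d ≠ 0 := IsFractionRing.to_map_ne_zero_of_mem_nonZeroDivisors hd
  obtain ⟨s, hs, h⟩ := hR.exists_dvd_mul_or_dvd_mul M (a * d) (b * c)
  refine ⟨s, hs, h.imp ?_ ?_⟩ <;>
  · rintro ⟨r, hr⟩
    refine ⟨r, ?_⟩
    have := congrArg (algebraMap R K) hr
    simp only [map_mul] at this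
    simp only [Algebra.smul_def]
    field_simp
    linear_combination this

theorem IsPruferDomain.le_or_le_of_isPrime (hR : IsPruferDomain R) {P Q M : Ideal R} [M.IsPrime]
    [hP : P.IsPrime] [hQ : Q.IsPrime] (hPM : P ≤ M) (hQM : Q ≤ M) : P ≤ Q ∨ Q ≤ P := by
  by_contra! h
  obtain ⟨a, haP, haQ⟩ := Set.not_subset.1 h.1
  obtain ⟨b, hbQ, hbP⟩ := Set.not_subset.1 h.2
  obtain ⟨s, hs, ⟨r, hr⟩ | ⟨r, hr⟩⟩ := hR.exists_dvd_mul_or_dvd_mul M a b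
  · exact (hQ.mem_or_mem (hr ▸ Q.mul_mem_right r hbQ)).elim (fun h => hs (hQM h)) haQ
  · exact (hP.mem_or_mem (hr ▸ P.mul_mem_right r haP)).elim (fun h => hs (hPM h)) hbP

end Prufer

/-! ### General properties of star operations. -/

namespace StarOperation

variable {R K : Type*} [CommRing R] [IsDomain R] [Field K] [Algebra R K] [IsFractionRing R K]

theorem map_zero (star : StarOperation R K) : star.toFun 0 = 0 := by
  simpa using star.map_smul 0 0

theorem spanSingleton_mul_apply_le (star : StarOperation R K) {x y : K}
    {I J : FractionalIdeal R⁰ K}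
    (h : FractionalIdeal.spanSingleton R⁰ x * I ≤ FractionalIdeal.spanSingleton R⁰ y * J) :
    FractionalIdeal.spanSingleton R⁰ x * star.toFun I ≤
      FractionalIdeal.spanSingleton R⁰ y * star.toFun J := by
  rw [← star.map_smul, ← star.map_smul]
  exact star.mono _ _ h

theorem apply_mul_le (star : StarOperation R K) (I J : FractionalIdeal R⁰ K) :
    star.toFun I * J ≤ star.toFun (I * J) := by
  rw [FractionalIdeal.mul_le]
  intro i hi j hj
  have h : FractionalIdeal.spanSingleton R⁰ j * star.toFun I ≤ star.toFun (I * J) := by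
    rw [← star.map_smul, mul_comm I J]
    exact star.mono _ _ (by gcongr; exact FractionalIdeal.spanSingleton_le_iff_mem.2 hj)
  rw [mul_comm i j]
  exact FractionalIdeal.spanSingleton_mul_le_iff.1 h i hi

/-- If R ⊆ A^⋆ and R ⊆ B^⋆, then B ⊆ A^⋆ B ⊆ (AB)^⋆; applying ⋆ again gives R ⊆ B^⋆ ⊆ (AB)^⋆. -/
theorem one_le_apply_coeIdeal_prod (star : StarOperation R K) {ι : Type*} (F : Finset ι)
    (I : ι → Ideal R) (h : ∀ i ∈ F, 1 ≤ star.toFun (I i : FractionalIdeal R⁰ K)) :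
    1 ≤ star.toFun ((∏ i ∈ F, I i : Ideal R) : FractionalIdeal R⁰ K) := by
  classical
  induction F using Finset.induction_on with
  | empty => simp [star.map_one]
  | insert i F hi ih =>
    rw [Finset.prod_insert hi, FractionalIdeal.coeIdeal_mul]
    have hF := ih fun j hj => h j (Finset.mem_insert_of_mem hj)
    have hi' := h i (Finset.mem_insert_self i F)
    refine hF.trans ?_
    rw [← star.idem ((I i : FractionalIdeal R⁰ K) * _)]
    refine star.mono _ _ (le_trans ?_ (star.apply_mul_le _ _))
    calc _ = 1 * ((∏ i ∈ F, I i : Ideal R) : FractionalIdeal R⁰ K) := (one_mul _).symm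
      _ ≤ _ := by gcongr

theorem DistributesOverIntersections.distributesOverFiniteIntersections {star : StarOperation R K}
    (h : star.DistributesOverIntersections) : star.DistributesOverFiniteIntersections := by
  intro I J
  -- Families with zero intersection are excluded from the hypothesis, so zero ideals are treated
  -- separately.
  by_cases hI : I = 0
  · subst hI
    rw [inf_eq_left.2 (FractionalIdeal.zero_le J), star.map_zero,
      inf_eq_left.2 (FractionalIdeal.zero_le _)]
  by_cases hJ : J = 0
  · subst hJ
    rw [inf_eq_right.2 (FractionalIdeal.zero_le I), star.map_zero,
      inf_eq_right.2 (FractionalIdeal.zero_le _)]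
  have hIJ : I ⊓ J ≠ 0 := by
    obtain ⟨x, hx, hxI⟩ := FractionalIdeal.exists_ne_zero_mem_isInteger hI
    obtain ⟨y, hy, hyJ⟩ := FractionalIdeal.exists_ne_zero_mem_isInteger hJ
    intro h0
    have hmem : algebraMap R K (x * y) ∈ I ⊓ J := by
      rw [map_mul, ← FractionalIdeal.mem_coe, FractionalIdeal.coe_inf]
      refine ⟨?_, ?_⟩
      · rw [mul_comm, ← Algebra.smul_def]; exact Submodule.smul_mem _ _ hxI
      · rw [← Algebra.smul_def]; exact Submodule.smul_mem _ _ hyJ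
    rw [h0, FractionalIdeal.mem_zero_iff] at hmem
    exact mul_ne_zero hx hy ((FaithfulSMul.algebraMap_eq_zero_iff R K).1 hmem)
  have := h {I, J} (I ⊓ J) ⟨I, by simp⟩ hIJ (by rw [iInf_pair, FractionalIdeal.coe_inf])
  apply FractionalIdeal.coeToSubmodule_injective
  exact this.trans (iInf_pair.trans (FractionalIdeal.coe_inf _ _).symm)

end StarOperation

/-! ### Star operations on h-local Prüfer domains. -/

section HLocal

variable {R K : Type*} [CommRing R] [IsDomain R] [Field K] [Algebra R K] [IsFractionRing R K]

open Submodule in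
theorem FractionalIdeal.exists_ne_zero_forall_smul_mem_span (I : FractionalIdeal R⁰ K) {y : K}
    (hy : y ≠ 0) : ∃ c : R, c ≠ 0 ∧ ∀ w ∈ I, c • w ∈ span R {y} := by
  obtain ⟨c, hc, h⟩ := (FractionalIdeal.spanSingleton R⁰ y⁻¹ * I).isFractional
  refine ⟨c, nonZeroDivisors.ne_zero hc, fun w hw => ?_⟩
  obtain ⟨r, hr⟩ := h (y⁻¹ * w) (FractionalIdeal.mem_singleton_mul.2 ⟨w, hw, rfl⟩)
  refine mem_span_singleton.2 ⟨r, ?_⟩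
  rw [Algebra.smul_def, hr, Algebra.smul_def, Algebra.smul_def]
  field_simp

open Submodule in
/-- In an `h`-local domain, `(R y : I)` localizes correctly at maximal ideals. -/
theorem IsHLocal.exists_forall_smul_mem_span (hR : IsHLocal R) (M : MaximalSpectrum R)
    (I : FractionalIdeal R⁰ K) {y : K} (hy : y ≠ 0)
    (h : ∀ w ∈ I, ∃ s ∉ M.asIdeal, s • w ∈ span R {y}) :
    ∃ s ∉ M.asIdeal, ∀ w ∈ I, s • w ∈ span R {y} := by
  -- The element c is a crude denominator; s will absorb it at every N ≠ M, while the hypothesis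
  -- handles M itself.
  obtain ⟨c, hc, hcI⟩ := I.exists_ne_zero_forall_smul_mem_span hy
  obtain ⟨s, hs, hsN⟩ := hR.1.exists_forall_dvd_mul hc M {N | N ≠ M} (by
    intro N hN Q hQ hQM hQN hcQ
    obtain ⟨M', -, huniq⟩ := hR.2 Q hQ (fun h0 => hc (by simpa [h0] using hcQ))
    exact hN (MaximalSpectrum.ext ((huniq _ ⟨N.isMaximal, hQN⟩).trans
      (huniq _ ⟨M.isMaximal, hQM⟩).symm)))
  refine ⟨s, hs, fun w hw => Submodule.mem_of_forall_maximalSpectrum fun N => ?_⟩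
  by_cases hN : N = M
  · subst hN
    obtain ⟨u, hu, hm⟩ := h w hw
    exact ⟨u, hu, by rw [smul_comm]; exact smul_mem _ _ hm⟩
  · obtain ⟨u, hu, d, hd⟩ := hsN N hN
    exact ⟨u, hu, by rw [smul_smul, hd, mul_comm, mul_smul]; exact smul_mem _ _ (hcI w hw)⟩

open Submodule in
theorem IsPruferDomain.exists_smul_mem_span_or (hR : IsPruferDomain R) (M : Ideal R) [M.IsPrime]
    (x y : K) : ∃ s ∉ M, s • x ∈ span R {y} ∨ s • y ∈ span R {x} := by
  obtain ⟨s, hs, ⟨r, h⟩ | ⟨r, h⟩⟩ := hR.exists_smul_eq_smul_or M x y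
  · exact ⟨s, hs, Or.inl (mem_span_singleton.2 ⟨r, h.symm⟩)⟩
  · exact ⟨s, hs, Or.inr (mem_span_singleton.2 ⟨r, h.symm⟩)⟩

open Submodule in
theorem IsPruferDomain.exists_smul_mem_span_of_notMem (hR : IsPruferDomain R) {M : Ideal R}
    [M.IsPrime] {I : Submodule R K} {y : K} (hy : ∀ u ∉ M, u • y ∉ I) {w : K} (hw : w ∈ I) :
    ∃ s ∉ M, s • w ∈ span R {y} := by
  obtain ⟨s, hs, h | h⟩ := hR.exists_smul_mem_span_or M w y
  · exact ⟨s, hs, h⟩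
  · exact absurd (span_le.2 (Set.singleton_subset_iff.2 hw) h) (hy s hs)

open Submodule in
-- As R_M is a valuation domain, I R_M ⊆ yM R_M, so sI ⊆ yM for some s ∉ M. Applying ⋆ gives sy ∈
-- yM^⋆, so M^⋆ contains both s and M.
theorem IsHLocal.one_le_apply_coeIdeal (hR : IsHLocal R) (hP : IsPruferDomain R)
    (star : StarOperation R K) {I : FractionalIdeal R⁰ K} {y : K} (hy0 : y ≠ 0)
    (hy : y ∈ star.toFun I) (M : MaximalSpectrum R)
    (hM : ∀ u ∉ M.asIdeal, u • y ∉ I) :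
    1 ≤ star.toFun (M.asIdeal : FractionalIdeal R⁰ K) := by
  have hloc : ∀ w ∈ I, ∃ s ∉ M.asIdeal, s • w ∈ span R {y} := fun w hw =>
    hP.exists_smul_mem_span_of_notMem (I := (I : Submodule R K)) hM hw
  obtain ⟨s, hs, hsI⟩ := hR.exists_forall_smul_mem_span M I hy0 hloc
  have hle : FractionalIdeal.spanSingleton R⁰ (algebraMap R K s) * I ≤
      FractionalIdeal.spanSingleton R⁰ y * M.asIdeal := by
    refine FractionalIdeal.spanSingleton_mul_le_iff.2 fun w hw => ?_
    obtain ⟨q, hq⟩ := mem_span_singleton.1 (hsI w hw)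
    refine FractionalIdeal.mem_singleton_mul.2
      ⟨algebraMap R K q, FractionalIdeal.mem_coeIdeal_of_mem _ ?_, ?_⟩
    · by_contra hqM
      exact hM q hqM (hq ▸ (I : Submodule R K).smul_mem s hw)
    · rw [← Algebra.smul_def, ← hq, Algebra.smul_def, mul_comm]
  have h := FractionalIdeal.spanSingleton_mul_le_iff.1 (star.spanSingleton_mul_apply_le hle) y hy
  obtain ⟨t, ht, hst⟩ := FractionalIdeal.mem_singleton_mul.1 h
  rw [mul_comm] at hst
  obtain rfl := mul_left_cancel₀ hy0 hst
  obtain ⟨v, m, hm, hvm⟩ := M.isMaximal.exists_inv hs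
  rw [FractionalIdeal.one_le, ← map_one (algebraMap R K), ← hvm, map_add, map_mul,
    ← Algebra.smul_def]
  exact (star.toFun _ : Submodule R K).add_mem ((star.toFun _ : Submodule R K).smul_mem _ ht)
    (star.le_apply _ (FractionalIdeal.mem_coeIdeal_of_mem _ hm))

open Submodule in
-- Otherwise sI ⊆ xyR for some s ∉ M; applying ⋆ gives sy ∈ xyR, so s ∈ xR ⊆ M.
theorem IsHLocal.exists_smul_smul_mem (hR : IsHLocal R) (hP : IsPruferDomain R)
    (star : StarOperation R K) {I : FractionalIdeal R⁰ K} {y : K} (hy0 : y ≠ 0)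
    (hy : y ∈ star.toFun I) (M : MaximalSpectrum R) {x : R}
    (hx : x ∈ M.asIdeal) : ∃ u ∉ M.asIdeal, u • x • y ∈ I := by
  by_contra! hM
  have hx0 : x ≠ 0 := by
    rintro rfl
    exact hM 1 (fun h => M.isMaximal.ne_top (M.asIdeal.eq_top_iff_one.2 h))
      (by rw [zero_smul, smul_zero]; exact FractionalIdeal.zero_mem I)
  have hloc : ∀ w ∈ I, ∃ s ∉ M.asIdeal, s • w ∈ span R {x • y} := fun w hw =>
    hP.exists_smul_mem_span_of_notMem (I := (I : Submodule R K)) hM hw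
  obtain ⟨s, hs, hsI⟩ := hR.exists_forall_smul_mem_span M I (smul_ne_zero hx0 hy0) hloc
  have hle : FractionalIdeal.spanSingleton R⁰ (algebraMap R K s) * I ≤
      FractionalIdeal.spanSingleton R⁰ (x • y) * 1 := by
    refine FractionalIdeal.spanSingleton_mul_le_iff.2 fun w hw => ?_
    rw [mul_one, FractionalIdeal.mem_spanSingleton, ← Algebra.smul_def]
    exact mem_span_singleton.1 (hsI w hw)
  have h := FractionalIdeal.spanSingleton_mul_le_iff.1 (star.spanSingleton_mul_apply_le hle) y hy
  rw [star.map_one, mul_one, FractionalIdeal.mem_spanSingleton] at h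
  obtain ⟨r, hr⟩ := h
  rw [smul_smul, ← Algebra.smul_def] at hr
  have := smul_left_injective R hy0 hr
  exact hs (this ▸ M.asIdeal.mul_mem_left r hx)

theorem IsHLocal.distributesOverIntersections (hR : IsHLocal R) (hP : IsPruferDomain R)
    (star : StarOperation R K) :
    star.DistributesOverIntersections := by
  intro S J hS hJ hJS
  refine le_antisymm (le_iInf₂ fun I hI => star.mono _ _ ?_) fun y hy => ?_
  · rw [← FractionalIdeal.coe_le_coe, hJS]
    exact iInf₂_le I hI
  simp only [Submodule.mem_iInf] at hy
  by_cases hy0 : y = 0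
  · subst hy0; exact zero_mem _
  obtain ⟨d, hd0, hd⟩ : ∃ d : R, d ≠ 0 ∧ d • y ∈ J := by
    obtain ⟨j, hj, hjJ⟩ := FractionalIdeal.exists_ne_zero_mem_isInteger hJ
    obtain ⟨a, b, hb, rfl⟩ := IsFractionRing.div_surjective R y
    have hb' := IsFractionRing.to_map_ne_zero_of_mem_nonZeroDivisors (K := K) hb
    refine ⟨b * j, mul_ne_zero (nonZeroDivisors.ne_zero hb) hj, ?_⟩
    have : (b * j) • (algebraMap R K a / algebraMap R K b) = a • algebraMap R K j := by
      simp only [Algebra.smul_def, map_mul]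
      field_simp
    rw [this]
    exact (J : Submodule R K).smul_mem a hjJ
  -- Where d is a unit, y is already locally in J; so only maximal ideals containing d can obstruct.
  let F := (((isLocallyFiniteDomain_iff.1 hR.1) d hd0).inter_of_left
    {M | 1 ≤ star.toFun (M.asIdeal : FractionalIdeal R⁰ K)}).toFinset
  have hone := star.one_le_apply_coeIdeal_prod F (fun M => M.asIdeal) (fun M hM =>
    ((Set.Finite.mem_toFinset _).1 hM).2)
  have hle : FractionalIdeal.spanSingleton R⁰ y *
      ((∏ M ∈ F, M.asIdeal : Ideal R) : FractionalIdeal R⁰ K) ≤ J := by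
    refine FractionalIdeal.spanSingleton_mul_le_iff.2 fun z hz => ?_
    obtain ⟨x, hx, rfl⟩ := (FractionalIdeal.mem_coeIdeal _).1 hz
    rw [mul_comm, ← Algebra.smul_def, ← FractionalIdeal.mem_coe, hJS]
    simp only [Submodule.mem_iInf]
    intro I hI
    have hJI : (J : Submodule R K) ≤ I := hJS ▸ iInf₂_le I hI
    refine Submodule.mem_of_forall_maximalSpectrum fun M => ?_
    by_cases hM : ∃ u ∉ M.asIdeal, u • y ∈ I
    · obtain ⟨u, hu, huy⟩ := hM
      exact ⟨u, hu, by rw [smul_comm]; exact (I : Submodule R K).smul_mem x huy⟩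
    · push Not at hM
      have hdM : d ∈ M.asIdeal := by
        by_contra hdM
        exact hM d hdM (hJI hd)
      have hMF : M ∈ F := (Set.Finite.mem_toFinset _).2
        ⟨hdM, hR.one_le_apply_coeIdeal hP star hy0 (hy I hI) M hM⟩
      exact hR.exists_smul_smul_mem hP star hy0 (hy I hI) M
        (Ideal.le_of_dvd (Finset.dvd_prod_of_mem _ hMF) hx)
  have h := star.mono _ _ hle
  rw [star.map_smul] at h
  have := FractionalIdeal.spanSingleton_mul_le_iff.1 h 1 (hone (FractionalIdeal.one_mem_one _))
  rwa [mul_one] at this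

end HLocal

/-! ### Localizing fractional ideals and the v-operation. -/

theorem mem_one_subalgebra_iff {R K : Type*} [CommRing R] [Field K] [Algebra R K]
    {T : Subalgebra R K} [IsFractionRing T K] {x : K} :
    x ∈ (1 : FractionalIdeal T⁰ K) ↔ x ∈ T := by
  rw [FractionalIdeal.mem_one_iff]
  exact ⟨fun ⟨t, ht⟩ => ht ▸ t.2, fun hx => ⟨⟨x, hx⟩, rfl⟩⟩

section Localization

variable {R K : Type*} [CommRing R] [IsDomain R] [Field K] [Algebra R K] [IsFractionRing R K]

theorem mem_vOperation_iff {I : FractionalIdeal R⁰ K} (hI : I ≠ 0) {y : K} :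
    y ∈ (vOperation R K).toFun I ↔
      ∀ z : K, (∀ w ∈ I, z * w ∈ (1 : FractionalIdeal R⁰ K)) →
        y * z ∈ (1 : FractionalIdeal R⁰ K) := by
  change y ∈ 1 / (1 / I) ↔ _
  rw [FractionalIdeal.mem_div_iff_of_ne_zero
    (FractionalIdeal.one_div_ne_zero_of_ne_zero R K hI)]
  simp only [FractionalIdeal.mem_div_iff_of_ne_zero hI]

theorem mem_localizationIn_iff {M : MaximalSpectrum R} {x : K} :
    x ∈ localizationIn R K M ↔ ∃ u ∉ M.asIdeal, u • x ∈ (1 : FractionalIdeal R⁰ K) := by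
  change (∃ a s, ∃ _ : s ∈ M.asIdeal.primeCompl,
    x = algebraMap R K a * (algebraMap R K s)⁻¹) ↔ _
  have hne : ∀ {s : R}, s ∉ M.asIdeal → algebraMap R K s ≠ 0 := fun {s} hs h0 =>
    hs ((FaithfulSMul.algebraMap_eq_zero_iff R K).1 h0 ▸ M.asIdeal.zero_mem)
  constructor
  · rintro ⟨a, s, hs, rfl⟩
    refine ⟨s, hs, (FractionalIdeal.mem_one_iff _).2 ⟨a, ?_⟩⟩
    have := hne hs
    rw [Algebra.smul_def]
    field_simp
  · rintro ⟨s, hs, h⟩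
    obtain ⟨a, ha⟩ := (FractionalIdeal.mem_one_iff _).1 h
    have := hne hs
    refine ⟨a, s, hs, ?_⟩
    rw [ha, Algebra.smul_def]
    field_simp

theorem mem_one_of_forall_mem_localizationIn {x : K}
    (h : ∀ M : MaximalSpectrum R, x ∈ localizationIn R K M) :
    x ∈ (1 : FractionalIdeal R⁰ K) :=
  Submodule.mem_of_forall_maximalSpectrum (I := ((1 : FractionalIdeal R⁰ K) : Submodule R K))
    fun M => mem_localizationIn_iff.1 (h M)

theorem mem_extendToOverring_localizationIn_iff {M : MaximalSpectrum R}
    {I : FractionalIdeal R⁰ K} {x : K} :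
    x ∈ extendToOverring (localizationIn R K M) I ↔ ∃ u ∉ M.asIdeal, u • x ∈ I := by
  change x ∈ Submodule.span (localizationIn R K M) (I : Set K) ↔ _
  constructor
  · intro hx
    induction hx using Submodule.span_induction with
    | mem y hy =>
      exact ⟨1, fun h => M.isMaximal.ne_top (M.asIdeal.eq_top_iff_one.2 h), by rwa [one_smul]⟩
    | zero =>
      exact ⟨1, fun h => M.isMaximal.ne_top (M.asIdeal.eq_top_iff_one.2 h), by
        rw [smul_zero]; exact FractionalIdeal.zero_mem I⟩
    | add y z _ _ hy hz =>
      obtain ⟨u, hu, huy⟩ := hy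
      obtain ⟨v, hv, hvz⟩ := hz
      refine ⟨u * v, M.isMaximal.isPrime.mul_notMem hu hv, ?_⟩
      rw [smul_add, mul_comm, mul_smul, mul_comm, mul_smul]
      exact (I : Submodule R K).add_mem ((I : Submodule R K).smul_mem v huy)
        ((I : Submodule R K).smul_mem u hvz)
    | smul t y _ hy =>
      obtain ⟨u, hu, huy⟩ := hy
      obtain ⟨v, hv, hvt⟩ := mem_localizationIn_iff.1 t.2
      obtain ⟨r, hr⟩ := (FractionalIdeal.mem_one_iff _).1 hvt
      refine ⟨u * v, M.isMaximal.isPrime.mul_notMem hu hv, ?_⟩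
      have : (u * v) • t • y = r • u • y := by
        rw [Algebra.smul_def r, hr, Subalgebra.smul_def, mul_smul, smul_eq_mul, smul_mul_assoc,
          mul_smul_comm, smul_comm]
      rw [this]
      exact (I : Submodule R K).smul_mem r huy
  · rintro ⟨u, hu, hux⟩
    obtain ⟨t, ht⟩ : ∃ t : localizationIn R K M, (t : K) = (algebraMap R K u)⁻¹ :=
      ⟨⟨(algebraMap R K u)⁻¹, ⟨1, u, hu, by simp⟩⟩, rfl⟩
    have hu0 : algebraMap R K u ≠ 0 := fun h0 =>
      hu ((FaithfulSMul.algebraMap_eq_zero_iff R K).1 h0 ▸ M.asIdeal.zero_mem)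
    have : x = t • u • x := by
      rw [Subalgebra.smul_def, ht, smul_eq_mul, Algebra.smul_def]
      field_simp
    rw [this]
    exact Submodule.smul_mem _ _ (Submodule.subset_span hux)

theorem le_extendToOverring (T : Subalgebra R K) [IsFractionRing T K] {I : FractionalIdeal R⁰ K}
    {x : K} (hx : x ∈ I) : x ∈ extendToOverring T I :=
  Submodule.subset_span hx

theorem extendToOverring_mono (T : Subalgebra R K) [IsFractionRing T K]
    {I J : FractionalIdeal R⁰ K} (h : I ≤ J) : extendToOverring T I ≤ extendToOverring T J :=
  Submodule.span_mono h

theorem extendToOverring_zero (T : Subalgebra R K) [IsFractionRing T K] :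
    extendToOverring T (0 : FractionalIdeal R⁰ K) = 0 := by
  apply FractionalIdeal.coeToSubmodule_injective
  change Submodule.span T (((0 : FractionalIdeal R⁰ K) : Submodule R K) : Set K) = _
  simp

theorem extendToOverring_ne_zero (T : Subalgebra R K) [IsFractionRing T K]
    {I : FractionalIdeal R⁰ K} (hI : I ≠ 0) : extendToOverring T I ≠ 0 := by
  obtain ⟨x, hx, hxI⟩ := FractionalIdeal.exists_ne_zero_mem_isInteger hI
  intro h0
  have := le_extendToOverring T hxI
  rw [h0, FractionalIdeal.mem_zero_iff] at this
  exact hx ((FaithfulSMul.algebraMap_eq_zero_iff R K).1 this)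

theorem extendToOverring_localizationIn_inf (M : MaximalSpectrum R) (I J : FractionalIdeal R⁰ K) :
    extendToOverring (localizationIn R K M) (I ⊓ J) =
      extendToOverring (localizationIn R K M) I ⊓ extendToOverring (localizationIn R K M) J := by
  refine le_antisymm
    (le_inf (extendToOverring_mono _ inf_le_left) (extendToOverring_mono _ inf_le_right)) ?_
  rintro x ⟨hxI, hxJ⟩
  obtain ⟨u, hu, huI⟩ := mem_extendToOverring_localizationIn_iff.1 hxI
  obtain ⟨v, hv, hvJ⟩ := mem_extendToOverring_localizationIn_iff.1 hxJ
  refine mem_extendToOverring_localizationIn_iff.2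
    ⟨u * v, M.isMaximal.isPrime.mul_notMem hu hv, ?_⟩
  refine ⟨?_, ?_⟩
  · rw [mul_comm, mul_smul]; exact (I : Submodule R K).smul_mem v huI
  · rw [mul_smul]; exact (J : Submodule R K).smul_mem u hvJ

theorem IsPruferDomain.extendToOverring_le_or_le (hR : IsPruferDomain R) (M : MaximalSpectrum R)
    (I J : FractionalIdeal R⁰ K) :
    extendToOverring (localizationIn R K M) I ≤ extendToOverring (localizationIn R K M) J ∨
      extendToOverring (localizationIn R K M) J ≤ extendToOverring (localizationIn R K M) I := by
  refine or_iff_not_imp_left.2 fun h => ?_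
  have h' : ¬ (I : Set K) ⊆ extendToOverring (localizationIn R K M) J := fun h' =>
    h (Submodule.span_le.2 h')
  obtain ⟨x, hx, hxJ⟩ := Set.not_subset.1 h'
  refine Submodule.span_le.2 fun y hy => ?_
  obtain ⟨s, hs, hsy⟩ := hR.exists_smul_mem_span_of_notMem (I := (J : Submodule R K)) (y := x)
    (fun u hu hux => hxJ (mem_extendToOverring_localizationIn_iff.2 ⟨u, hu, hux⟩)) hy
  exact mem_extendToOverring_localizationIn_iff.2
    ⟨s, hs, Submodule.span_le.2 (Set.singleton_subset_iff.2 hx) hsy⟩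

/-- The `v`-operations of the localizations at maximal ideals of a Prüfer domain are stable. -/
theorem IsPruferDomain.vOperation_extendToOverring_inf (hR : IsPruferDomain R)
    (M : MaximalSpectrum R) (I J : FractionalIdeal R⁰ K) :
    (vOperation (localizationIn R K M) K).toFun
        (extendToOverring (localizationIn R K M) (I ⊓ J)) =
      (vOperation (localizationIn R K M) K).toFun (extendToOverring (localizationIn R K M) I) ⊓
      (vOperation (localizationIn R K M) K).toFun (extendToOverring (localizationIn R K M) J) := by
  rw [extendToOverring_localizationIn_inf]
  obtain h | h := hR.extendToOverring_le_or_le M I J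
  · rw [inf_eq_left.2 h, inf_eq_left.2 ((vOperation _ K).mono _ _ h)]
  · rw [inf_eq_right.2 h, inf_eq_right.2 ((vOperation _ K).mono _ _ h)]

theorem IsPruferDomain.vOperation_distributesOverFiniteIntersections (hR : IsPruferDomain R)
    (h : ∀ I : FractionalIdeal R⁰ K,
      (((vOperation R K).toFun I : Submodule R K) : Set K) =
        ⋂ M : MaximalSpectrum R,
          (((vOperation (localizationIn R K M) K).toFun
            (extendToOverring (localizationIn R K M) I) :
              Submodule (localizationIn R K M) K) : Set K)) :
    (vOperation R K).DistributesOverFiniteIntersections := by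
  intro I J
  apply FractionalIdeal.coeToSubmodule_injective
  apply SetLike.coe_injective
  change _ = (((vOperation R K).toFun I : Submodule R K) : Set K) ∩
    (((vOperation R K).toFun J : Submodule R K) : Set K)
  refine (h (I ⊓ J)).trans ?_
  rw [h I, h J, ← Set.iInter_inter_distrib]
  refine Set.iInter_congr fun M => ?_
  rw [hR.vOperation_extendToOverring_inf]
  rfl

theorem IsHLocal.vOperation_eq_iInter (hR : IsHLocal R) (I : FractionalIdeal R⁰ K) :
    (((vOperation R K).toFun I : Submodule R K) : Set K) =
      ⋂ M : MaximalSpectrum R,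
        (((vOperation (localizationIn R K M) K).toFun
          (extendToOverring (localizationIn R K M) I) :
            Submodule (localizationIn R K M) K) : Set K) := by
  by_cases hI : I = 0
  · subst hI
    simp only [extendToOverring_zero, StarOperation.map_zero]
    obtain ⟨M⟩ : Nonempty (MaximalSpectrum R) := inferInstance
    ext x
    simp
  ext y
  rw [Set.mem_iInter]
  change y ∈ (vOperation R K).toFun I ↔ ∀ M : MaximalSpectrum R,
    y ∈ (vOperation (localizationIn R K M) K).toFun (extendToOverring (localizationIn R K M) I)
  simp only [mem_vOperation_iff hI, mem_vOperation_iff (extendToOverring_ne_zero _ hI),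
    mem_one_subalgebra_iff]
  constructor
  · intro hy M z hz
    by_cases hz0 : z = 0
    · subst hz0; rw [mul_zero]; exact zero_mem _
    -- Rewriting zI ⊆ R_M as I ⊆ z⁻¹R_M lets one denominator s serve all of I, so that sz ∈ (R : I).
    have hspan : ∀ {a : R} {w : K}, a • w ∈ Submodule.span R {z⁻¹} ↔
        a • (z * w) ∈ (1 : FractionalIdeal R⁰ K) := by
      intro a w
      rw [Submodule.mem_span_singleton, FractionalIdeal.mem_one_iff]
      refine exists_congr fun r => ?_
      simp only [Algebra.smul_def]
      field_simp
    obtain ⟨s, hs, hsI⟩ := hR.exists_forall_smul_mem_span M I (inv_ne_zero hz0) fun w hw => by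
      obtain ⟨s, hs, h⟩ := mem_localizationIn_iff.1 (hz w (le_extendToOverring _ hw))
      exact ⟨s, hs, hspan.2 h⟩
    refine mem_localizationIn_iff.2 ⟨s, hs, ?_⟩
    rw [← mul_smul_comm]
    refine hy _ fun w hw => ?_
    rw [smul_mul_assoc]
    exact hspan.1 (hsI w hw)
  · intro hy z hz
    refine mem_one_of_forall_mem_localizationIn fun M => hy M z fun w hw => ?_
    obtain ⟨u, hu, huw⟩ := mem_extendToOverring_localizationIn_iff.1 hw
    exact mem_localizationIn_iff.2 ⟨u, hu, by rw [← mul_smul_comm]; exact hz _ huw⟩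

end Localization

/-! ### Stability of v rules out nonzero common primes. -/

/-- `P` is a largest prime ideal contained in both `M` and `N`. -/
structure IsLargestCommonPrime {R : Type*} [CommRing R] (P : Ideal R)
    (M N : MaximalSpectrum R) : Prop where
  isPrime : P.IsPrime
  le_left : P ≤ M.asIdeal
  le_right : P ≤ N.asIdeal
  le_of_le : ∀ Q : Ideal R, Q.IsPrime → P ≤ Q → Q ≤ M.asIdeal → Q ≤ N.asIdeal → Q ≤ P

theorem IsLargestCommonPrime.symm {R : Type*} [CommRing R] {P : Ideal R} {M N : MaximalSpectrum R}
    (h : IsLargestCommonPrime P M N) : IsLargestCommonPrime P N M :=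
  ⟨h.isPrime, h.le_right, h.le_left, fun Q hQ hP h1 h2 => h.le_of_le Q hQ hP h2 h1⟩

section Branching

variable {R K : Type*} [CommRing R] [IsDomain R] [Field K] [Algebra R K] [IsFractionRing R K]

/-- The maximal ideals which share with `M` a prime ideal strictly larger than `P`. -/
def branch (P : Ideal R) (M : MaximalSpectrum R) : Set (MaximalSpectrum R) :=
  {N | ∃ Q : Ideal R, Q.IsPrime ∧ P < Q ∧ Q ≤ M.asIdeal ∧ Q ≤ N.asIdeal}

variable (K) in
/-- The intersection of the localizations at the maximal ideals outside `branch P M`. -/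
noncomputable def offBranch (P : Ideal R) (M : MaximalSpectrum R) : Submodule R K :=
  ⨅ N ∈ (branch P M)ᶜ, Subalgebra.toSubmodule (localizationIn R K N)

theorem mem_offBranch_iff {P : Ideal R} {M : MaximalSpectrum R} {x : K} :
    x ∈ offBranch K P M ↔ ∀ N ∉ branch P M, x ∈ localizationIn R K N := by
  simp only [offBranch, Submodule.mem_iInf, Set.mem_compl_iff, Subalgebra.mem_toSubmodule]

namespace IsLargestCommonPrime

variable {P : Ideal R} {M N : MaximalSpectrum R}

/-- On the branch of N, the bound comes from M, which is off it: x has a denominator u ∉ M, so u ∉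
P, and in the valuation ring R_N' such a u divides every d ∈ P. -/
theorem smul_mem_one (h : IsLargestCommonPrime P M N) (hR : IsPruferDomain R) {d : R} (hd : d ∈ P)
    {x : K} (hx : x ∈ offBranch K P N) : d • x ∈ (1 : FractionalIdeal R⁰ K) := by
  have := h.isPrime
  rw [mem_offBranch_iff] at hx
  refine mem_one_of_forall_mem_localizationIn fun N' => ?_
  by_cases hN' : N' ∈ branch P N
  · have hMN : M ∉ branch P N := fun ⟨Q, hQ, hPQ, hQN, hQM⟩ =>
      hPQ.not_ge (h.le_of_le Q hQ hPQ.le hQM hQN)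
    obtain ⟨u, hu, hux⟩ := mem_localizationIn_iff.1 (hx M hMN)
    obtain ⟨Q, hQ, hPQ, hQN, hQN'⟩ := hN'
    obtain ⟨s, hs, ⟨e, he⟩ | ⟨e, he⟩⟩ := hR.exists_dvd_mul_or_dvd_mul N'.asIdeal d u
    · refine mem_localizationIn_iff.2 ⟨s, hs, ?_⟩
      rw [smul_smul, he, mul_comm, mul_smul]
      exact ((1 : FractionalIdeal R⁰ K) : Submodule R K).smul_mem e hux
    · exact ((this.mem_or_mem (he ▸ P.mul_mem_right e hd)).elim
        (fun hsP => hs (hQN' (hPQ.le hsP))) fun huP => hu (h.le_left huP)).elim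
  · exact (localizationIn R K N').smul_mem (hx N' hN') d

/-- For r ∉ P and t ∈ N \ P, some s ∉ N puts s/(rt) in every localization off the branch, since
common primes there lie in P and miss rt. Then r · s/(rt) = s/t ∈ R would force s ∈ tR ⊆ N. -/
theorem mem_of_forall_mul_mem_one (h : IsLargestCommonPrime P M N) (hMN : M ≠ N)
    (hR : IsPruferDomain R) (hfin : IsLocallyFiniteDomain R) {r : R}
    (hr : ∀ y ∈ offBranch K P N, r • y ∈ (1 : FractionalIdeal R⁰ K)) : r ∈ P := by
  have hP := h.isPrime
  by_contra hrP
  obtain ⟨t, htN, htP⟩ : ∃ t ∈ N.asIdeal, t ∉ P := by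
    by_contra! hNP
    exact hMN (MaximalSpectrum.ext
      (N.isMaximal.eq_of_le M.isMaximal.ne_top (le_trans hNP h.le_left)).symm)
  have hz : r * t ∉ P := hP.mul_notMem hrP htP
  have hz0 : r * t ≠ 0 := fun h0 => hz (h0 ▸ P.zero_mem)
  obtain ⟨s, hs, hsN⟩ := hfin.exists_forall_dvd_mul hz0 N (branch P N)ᶜ (by
    intro N' hN' Q hQ hQN hQN' hzQ
    refine hz ?_
    obtain hle | hle := hR.le_or_le_of_isPrime hQN h.le_right
    · exact hle hzQ
    · by_contra hzP
      exact hN' ⟨Q, hQ, lt_of_le_not_ge hle fun hQP => hzP (hQP hzQ), hQN, hQN'⟩)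
  have hz0' : algebraMap R K r * algebraMap R K t ≠ 0 := by
    rw [← map_mul]
    exact (FaithfulSMul.algebraMap_eq_zero_iff R K).not.2 hz0
  have hr0 := left_ne_zero_of_mul hz0'
  have ht0 := right_ne_zero_of_mul hz0'
  have hy : algebraMap R K s / algebraMap R K (r * t) ∈ offBranch K P N := by
    refine mem_offBranch_iff.2 fun N' hN' => mem_localizationIn_iff.2 ?_
    obtain ⟨u, hu, v, hv⟩ := hsN N' hN'
    refine ⟨u, hu, (FractionalIdeal.mem_one_iff _).2 ⟨v, ?_⟩⟩
    have := congrArg (algebraMap R K) hv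
    simp only [map_mul] at this
    simp only [Algebra.smul_def, map_mul]
    field_simp
    linear_combination -this
  obtain ⟨e, he⟩ := (FractionalIdeal.mem_one_iff _).1 (hr _ hy)
  have hst : e * t = s := by
    apply IsFractionRing.injective R K
    rw [map_mul, he, Algebra.smul_def, map_mul]
    field_simp
  exact hs (hst ▸ N.asIdeal.mul_mem_left e htN)

/-- Primes inside N' form a chain, so the smaller of the two witnesses would lie in both M and N. -/
theorem disjoint_branch (h : IsLargestCommonPrime P M N) (hR : IsPruferDomain R)
    {N' : MaximalSpectrum R} (hM : N' ∈ branch P M) : N' ∉ branch P N := by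
  rintro ⟨Q, hQ, hPQ, hQN, hQN'⟩
  obtain ⟨Q', hQ', hPQ', hQM, hQN''⟩ := hM
  obtain hle | hle := hR.le_or_le_of_isPrime hQN' hQN''
  · exact hPQ.not_ge (h.le_of_le Q hQ hPQ.le (hle.trans hQM) hQN)
  · exact hPQ'.not_ge (h.le_of_le Q' hQ' hPQ'.le hQM (hle.trans hQN))

variable (K) in
/-- If the `v`-operation is stable on a locally finite Prüfer domain, then no nonzero prime ideal
is the largest one inside two maximal ideals. -/
theorem eq_bot (h : IsLargestCommonPrime P M N) (hMN : M ≠ N) (hR : IsPruferDomain R)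
    (hfin : IsLocallyFiniteDomain R)
    (hv : (vOperation R K).DistributesOverFiniteIntersections) : P = ⊥ := by
  by_contra hP0
  obtain ⟨d, hdP, hd0⟩ := Submodule.exists_mem_ne_zero_of_ne_bot hP0
  have hfrac : ∀ {M' N' : MaximalSpectrum R}, IsLargestCommonPrime P M' N' →
      IsFractional R⁰ (offBranch K P N') := fun h' =>
    ⟨d, mem_nonZeroDivisors_of_ne_zero hd0, fun x hx =>
      (FractionalIdeal.mem_one_iff _).1 (h'.smul_mem_one hR hdP hx)⟩
  let I : FractionalIdeal R⁰ K := ⟨offBranch K P M, hfrac h.symm⟩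
  let J : FractionalIdeal R⁰ K := ⟨offBranch K P N, hfrac h⟩
  have hone : ∀ M' : MaximalSpectrum R, (1 : K) ∈ offBranch K P M' := fun M' =>
    mem_offBranch_iff.2 fun N' _ => one_mem _
  have hI0 : I ≠ 0 := fun h0 => one_ne_zero
    ((FractionalIdeal.mem_zero_iff R⁰).1 (h0 ▸ hone M : (1 : K) ∈ (0 : FractionalIdeal R⁰ K)))
  have hIJ : I ⊓ J = 1 := by
    refine le_antisymm ?_ (FractionalIdeal.one_le.2 ⟨hone M, hone N⟩)
    rintro x ⟨hxI, hxJ⟩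
    refine mem_one_of_forall_mem_localizationIn fun N' => ?_
    by_cases hN' : N' ∈ branch P M
    · exact mem_offBranch_iff.1 hxJ N' (h.disjoint_branch hR hN')
    · exact mem_offBranch_iff.1 hxI N' hN'
  have hvIJ := hv I J
  rw [hIJ, (vOperation R K).map_one] at hvIJ
  have hJ1 : J ≤ 1 := by
    rw [hvIJ]
    -- J ⊆ I^v because (R : I) ⊆ P and PJ ⊆ R; each z ∈ (R : I) lies in R since 1 ∈ I.
    refine le_inf (fun x hx => ?_) ((vOperation R K).le_apply J)
    refine (mem_vOperation_iff hI0).2 fun z hz => ?_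
    obtain ⟨r, rfl⟩ := (FractionalIdeal.mem_one_iff _).1 (mul_one z ▸ hz 1 (hone M))
    rw [mul_comm, ← Algebra.smul_def]
    refine h.smul_mem_one hR (h.symm.mem_of_forall_mul_mem_one (K := K) hMN.symm hR
      hfin fun y hy => ?_) hx
    rw [Algebra.smul_def]
    exact hz y hy
  have h1P : (1 : R) ∈ P := h.mem_of_forall_mul_mem_one (K := K) hMN hR hfin fun y hy => by
    rw [one_smul]; exact hJ1 hy
  exact h.isPrime.ne_top (P.eq_top_iff_one.2 h1P)

end IsLargestCommonPrime

theorem IsPruferDomain.isHLocal_of_vOperation_distributesOverFiniteIntersections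
    (hR : IsPruferDomain R) (hfin : IsLocallyFiniteDomain R)
    (hv : (vOperation R K).DistributesOverFiniteIntersections) : IsHLocal R := by
  refine ⟨hfin, fun P hP hP0 => ?_⟩
  obtain ⟨M, hM, hPM⟩ := Ideal.exists_le_maximal P hP.ne_top
  refine ⟨M, ⟨hM, hPM⟩, fun N hN => ?_⟩
  by_contra hNM
  obtain ⟨Q, hPQ, hQ⟩ := Ideal.exists_le_maximal_isPrime_le (le_inf hN.2 hPM)
  have hQc : IsLargestCommonPrime Q ⟨N, hN.1⟩ ⟨M, hM⟩ :=
    ⟨hQ.prop.1, hQ.prop.2.trans inf_le_left, hQ.prop.2.trans inf_le_right,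
      fun Q' hQ' hle hN' hM' => hQ.le_of_ge ⟨hQ', le_inf hN' hM'⟩ hle⟩
  have hQ0 := hQc.eq_bot K (fun h => hNM (congrArg MaximalSpectrum.asIdeal h)) hR hfin hv
  exact hP0 (le_bot_iff.1 (hQ0 ▸ hPQ))

end Branching

theorem mainTheorem6 (R K : Type*) [CommRing R] [IsDomain R] [Field K] [Algebra R K]
    [IsFractionRing R K] (hR : IsPruferDomain R)
    (h : IsSemilocalRing R ∨ (IsLocallyFiniteDomain R ∧ FiniteRingKrullDim R)) :
    List.TFAE [
      IsHLocal R,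
      ∀ star : StarOperation R K, star.DistributesOverIntersections,
      ∀ star : StarOperation R K, star.DistributesOverFiniteIntersections,
      (vOperation R K).DistributesOverIntersections,
      (vOperation R K).DistributesOverFiniteIntersections,
      ∀ I : FractionalIdeal R⁰ K,
        (((vOperation R K).toFun I : Submodule R K) : Set K) =
          ⋂ M : MaximalSpectrum R,
            (((vOperation (localizationIn R K M) K).toFun
              (extendToOverring (localizationIn R K M) I) :
                Submodule (localizationIn R K M) K) : Set K)] := by
  have hfin : IsLocallyFiniteDomain R := h.elim (fun h => h.isLocallyFiniteDomain) And.left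
  tfae_have 1 → 2 := fun h => h.distributesOverIntersections hR
  tfae_have 2 → 3 := fun h star => (h star).distributesOverFiniteIntersections
  tfae_have 2 → 4 := fun h => h _
  tfae_have 3 → 5 := fun h => h _
  tfae_have 4 → 5 := fun h => h.distributesOverFiniteIntersections
  tfae_have 5 → 1 :=
    hR.isHLocal_of_vOperation_distributesOverFiniteIntersections hfin
  tfae_have 1 → 6 := fun h => h.vOperation_eq_iInter
  tfae_have 6 → 5 := hR.vOperation_distributesOverFiniteIntersections
  tfae_finish
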